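/- Let $(X,d)$ be a compact metric space and let $\mathcal F=(f_i)_{i\ge 1}$ be a non-autonomous dynamical system (NDS) on $X$, i.e. a sequence of continuous maps $f_i:X\to X$. Suppose that $(f_i)$ converges uniformly to a map $f:X\to X$. For $\alpha>0$, an $\alpha$-pseudo orbit of $\mathcal F$ is a sequence $(x_n)_{n\in\mathbb Z}$ in $X$ such that $d(f_{n+1}(x_n),x_{n+1})<\alpha$ for all $n\ge 0$ and such that for all $n\le -1$ there is $y\in f_{-n}^{-1}(x_{n+1})$ with $d(y,x_n)<\alpha$ (for bijective $f_{-n}$: $d(f_{-n}^{-1}(x_{n+1}),x_n)<\alpha$). A set $E$ of such sequences is $(n,\epsilon)$-separated if for any two distinct $\mathtt x,\mathtt y\in E$ there is $0\le k<n$ with $d(x_k,y_k)>\epsilon$. Let $c_n(\epsilon,\alpha,\mathcal F)$ be the maximal cardinality of an $(n,\epsilon)$-separated set of $\alpha$-pseudo orbits, and let $$h_p(\mathcal F)=\lim_{\epsilon\to 0}\,\lim_{\alpha\to 0}\,\limsup_{n\to\infty}\frac1n\log c_n(\epsilon,\alpha,\mathcal F)\in[-\infty,+\infty]$$ be the pseudo-entropy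 of $\mathcal F$ (with $\log 0=-\infty$). Let $h(f)\in[-\infty,+\infty]$ denote the topological entropy of $f$ (equal to $-\infty$ if $X=\emptyset$). Then $$h_p(\mathcal F)\le h(f).$$ The same inequality holds if, in the definition of $\alpha$-pseudo orbits, the condition for $n\le -1$ is dropped, so that all sequences with $d(f_{n+1}(x_n),x_{n+1})<\alpha$ for all $n\ge 0$ are admitted. -/

import Mathlib

open Filter Topology Set

noncomputable section

namespace NDS

variable {X : Type*} [MetricSpace X]

/-- The bi-infinite `δ`-pseudo orbits of the non-autonomous system `(f_i)_{i ≥ 1}` (the value `f 0`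
is not used): `d(f_{n+1}(x_n), x_{n+1}) < δ` for `n ≥ 0`, and, for each negative index `n = -m`,
the point `x_n` is at distance `< δ` from a point of `f_m⁻¹(x_{n+1})`.
If `f_m` is a bijection, the latter says `d(f_m⁻¹(x_{n+1}), x_n) < δ`. -/
def pseudoOrbits (f : ℕ → X → X) (δ : ℝ) : Set (ℤ → X) :=
  {x | (∀ n : ℕ, dist (f (n + 1) (x n)) (x (n + 1)) < δ) ∧
    ∀ m : ℕ, 1 ≤ m → ∃ y : X, f m y = x (-(m : ℤ) + 1) ∧ dist y (x (-(m : ℤ))) < δ}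

/-- The sequences that satisfy only the conditions at times `n ≥ 0`; the entries with negative
index are arbitrary. -/
def forwardPseudoOrbits (f : ℕ → X → X) (δ : ℝ) : Set (ℤ → X) :=
  {x | ∀ n : ℕ, dist (f (n + 1) (x n)) (x (n + 1)) < δ}

/-- A set `E` of sequences is `(n, ε)`-separated if any two distinct members are at distance
`> ε` at some time `0 ≤ k < n`. -/
def IsSeparated (n : ℕ) (ε : ℝ) (E : Set (ℤ → X)) : Prop :=
  E.Pairwise fun x y => ∃ k : ℕ, k < n ∧ ε < dist (x k) (y k)

/-- The maximal cardinality of an `(n, ε)`-separated subset of `P`. -/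
def sepCard (P : Set (ℤ → X)) (n : ℕ) (ε : ℝ) : ℕ∞ :=
  ⨆ (E : Set (ℤ → X)) (_ : E ⊆ P ∧ IsSeparated n ε E), E.encard

/-- `limsup_{n → ∞} (1/n) log (sepCard P n ε)`. -/
def sepRate (P : Set (ℤ → X)) (ε : ℝ) : EReal :=
  limsup (fun n : ℕ => ENNReal.log (sepCard P n ε) / (n : EReal)) atTop

/-- `lim_{ε → 0} lim_{α → 0} limsup_{n → ∞} (1/n) log (sepCard (P α) n ε)` for a family of sets of
sequences that grows with `α`. Both limits are monotone, and are written as a supremum and an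
infimum; see `tendsto_sepRate_iInf` and `tendsto_iInf_sepRate`. -/
def sepEntropy (P : ℝ → Set (ℤ → X)) : EReal :=
  ⨆ (ε : ℝ) (_ : 0 < ε), ⨅ (α : ℝ) (_ : 0 < α), sepRate (P α) ε

/-- The pseudo-entropy of the non-autonomous system `(f_i)_{i ≥ 1}`. -/
def pseudoEntropy (f : ℕ → X → X) : EReal := sepEntropy (pseudoOrbits f)

/-- The same number, computed with all sequences that are pseudo orbits at times `n ≥ 0`. -/
def forwardPseudoEntropy (f : ℕ → X → X) : EReal := sepEntropy (forwardPseudoOrbits f)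

theorem monotone_pseudoOrbits (f : ℕ → X → X) : Monotone (pseudoOrbits f) := by
  intro a b hab x hx
  refine ⟨fun n => (hx.1 n).trans_le hab, fun m hm => ?_⟩
  obtain ⟨y, hy, hy'⟩ := hx.2 m hm
  exact ⟨y, hy, hy'.trans_le hab⟩

theorem monotone_forwardPseudoOrbits (f : ℕ → X → X) : Monotone (forwardPseudoOrbits f) :=
  fun _ _ hab _ hx n => (hx n).trans_le hab

theorem sepRate_mono {P Q : Set (ℤ → X)} {ε ε' : ℝ} (hPQ : P ⊆ Q) (h : ε' ≤ ε) :
    sepRate P ε ≤ sepRate Q ε' := by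
  refine limsup_le_limsup (Eventually.of_forall fun n => ?_)
  refine EReal.div_le_div_right_of_nonneg (by positivity) (ENNReal.log_monotone ?_)
  have : sepCard P n ε ≤ sepCard Q n ε' := by
    refine iSup₂_le fun E hE => le_iSup₂_of_le E ⟨hE.1.trans hPQ, ?_⟩ le_rfl
    exact hE.2.imp fun _ _ ⟨k, hk, hd⟩ => ⟨k, hk, h.trans_lt hd⟩
  exact_mod_cast this

/-- The inner limit exists and is the infimum. -/
theorem tendsto_sepRate_iInf {P : ℝ → Set (ℤ → X)} (hP : Monotone P) (ε : ℝ) :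
    Tendsto (fun α => sepRate (P α) ε) (𝓝[>] 0) (𝓝 (⨅ (α : ℝ) (_ : 0 < α), sepRate (P α) ε)) := by
  have hm : Monotone fun α => sepRate (P α) ε := fun a b hab => sepRate_mono (hP hab) le_rfl
  have := hm.tendsto_nhdsGT 0
  rwa [sInf_image] at this

/-- The outer limit exists and is the supremum. -/
theorem tendsto_iInf_sepRate (P : ℝ → Set (ℤ → X)) :
    Tendsto (fun ε => ⨅ (α : ℝ) (_ : 0 < α), sepRate (P α) ε) (𝓝[>] 0) (𝓝 (sepEntropy P)) := by
  have hm : Antitone fun ε => ⨅ (α : ℝ) (_ : 0 < α), sepRate (P α) ε :=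
    fun a b hab => iInf₂_mono fun α _ => sepRate_mono Subset.rfl hab
  have := hm.tendsto_nhdsGT 0
  rwa [sSup_image] at this

end NDS

end

namespace NDS

/-! From some time `N` on, the maps `f i` are uniformly close to the limit `g`, so tails of pseudo
orbits of `f` are pseudo orbits of `g`. Over a fixed length `m`, such tails stay close to true
`g`-orbits, hence to the `g`-orbits of the `B` centres of a minimal cover by dynamical balls of
length `m`. The block itinerary, plus a net for the first `N` entries, determines a sequence up to
`ε` before time `n`; so at most `A * B ^ (n / m + 1)` of them are separated
(`sepCard_le_of_blocks`), a growth rate of at most `log B / m`. Since `α → 0` is taken at fixed `ε`,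
`α` and `N` may depend on `m`, and `m → ∞` gives the entropy of `g`. Separation ignores negative
times. -/

/-- Finite pseudo orbits of a uniformly continuous map are shadowed by the orbits of their initial
points. -/
theorem exists_shadow_of_uniformContinuous {X : Type*} [PseudoMetricSpace X] {g : X → X}
    (hg : UniformContinuous g) (m : ℕ) {ε : ℝ} (hε : 0 < ε) :
    ∃ α : ℝ, 0 < α ∧ ∀ x : ℕ → X, (∀ k, dist (g (x k)) (x (k + 1)) < α) →
      ∀ k < m, dist (g^[k] (x 0)) (x k) < ε := by
  induction m generalizing ε with
  | zero => exact ⟨1, one_pos, fun _ _ k hk => absurd hk (Nat.not_lt_zero k)⟩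
  | succ m ih =>
    -- Error `δ` at time `k` becomes `ε / 2` under `g`; the jump to time `k + 1` costs the other `ε
    -- / 2`.
    obtain ⟨δ, hδ, hgδ⟩ := Metric.uniformContinuous_iff.1 hg (ε / 2) (half_pos hε)
    obtain ⟨α, hα, h⟩ := ih hδ
    refine ⟨min α (ε / 2), lt_min hα (half_pos hε), fun x hx k hk => ?_⟩
    cases k with
    | zero => simpa using hε
    | succ k =>
      rw [Function.iterate_succ_apply']
      have h1 := hgδ (h x (fun j => (hx j).trans_le (min_le_left _ _)) k (by omega))
      have h2 := (hx k).trans_le (min_le_right _ _)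
      linarith [dist_triangle (g (g^[k] (x 0))) (g (x k)) (x (k + 1))]

/-- The exponential growth rate of `A * B ^ (n / m + 1)` is at most `log B / m`. -/
theorem limsup_log_mul_pow_div_le (A B : ℕ) {m : ℕ} (hm : 0 < m) :
    limsup (fun n : ℕ => ENNReal.log ((A * B ^ (n / m + 1) : ℕ) : ENNReal) / (n : EReal)) atTop ≤
      ENNReal.log (B : ENNReal) / (m : EReal) := by
  have log_natCast : ∀ c : ℕ, c ≠ 0 → ENNReal.log (c : ENNReal) = ((Real.log c : ℝ) : EReal) := by
    intro c hc
    rw [← ENNReal.ofReal_natCast, ENNReal.log_ofReal_of_pos (by positivity)]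
  by_cases hAB : A = 0 ∨ B = 0
  · refine (limsup_le_of_le (a := ⊥) (by isBoundedDefault) ?_).trans bot_le
    -- `n = 0` is excluded because `⊥ / n = ⊥` needs a positive divisor.
    filter_upwards [eventually_gt_atTop 0] with n hn
    have h0 : A * B ^ (n / m + 1) = 0 := by rcases hAB with h | h <;> simp [h]
    rw [h0, Nat.cast_zero, ENNReal.log_zero]
    exact (EReal.bot_div_of_pos_ne_top (by exact_mod_cast hn) (EReal.natCast_ne_top n)).le
  · push Not at hAB
    obtain ⟨hA, hB⟩ := hAB
    have hb : 0 ≤ Real.log B := Real.log_natCast_nonneg B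
    have hlim : Tendsto (fun n : ℕ => (Real.log A + Real.log B) / (n : ℝ) + Real.log B / m) atTop
        (𝓝 (Real.log B / m)) := by
      simpa using (tendsto_const_div_atTop_nhds_zero_nat (Real.log A + Real.log B)).add_const
        (Real.log B / m)
    have hlim' := (continuous_coe_real_ereal.tendsto _).comp hlim
    rw [log_natCast B hB]
    have hR : ((Real.log B : ℝ) : EReal) / (m : EReal) = ((Real.log B / m : ℝ) : EReal) := by
      rw [EReal.coe_div]; rfl
    rw [hR, ← hlim'.limsup_eq]
    refine limsup_le_limsup ?_
    filter_upwards [eventually_gt_atTop 0] with n hn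
    rw [log_natCast _ (by positivity)]
    have hn' : (0 : ℝ) < n := by exact_mod_cast hn
    have hm' : (0 : ℝ) < m := by exact_mod_cast hm
    have hL : ((Real.log (A * B ^ (n / m + 1) : ℕ) : ℝ) : EReal) / (n : EReal) =
        ((Real.log (A * B ^ (n / m + 1) : ℕ) / n : ℝ) : EReal) := by
      rw [EReal.coe_div]; rfl
    rw [hL]
    refine EReal.coe_le_coe_iff.2 ?_
    have hdiv : ((n / m : ℕ) : ℝ) ≤ n / m := Nat.cast_div_le
    have hlog : Real.log (A * B ^ (n / m + 1) : ℕ) ≤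
        (Real.log A + Real.log B) + n / m * Real.log B := by
      push_cast
      rw [Real.log_mul (by positivity) (by positivity), Real.log_pow]
      push_cast
      nlinarith [mul_le_mul_of_nonneg_right hdiv hb]
    calc Real.log (A * B ^ (n / m + 1) : ℕ) / n
        ≤ ((Real.log A + Real.log B) + n / m * Real.log B) / n := by gcongr
      _ = _ := by field_simp

variable {X : Type*} [MetricSpace X]

/-- If the tails of the sequences in `P` are cut into blocks of length `m`, each of which stays
`ε / 2`-close to the `g`-orbit of a point of `s`, then `sepCard` is bounded by the number of
itineraries. -/
theorem sepCard_le_of_blocks {P : Set (ℤ → X)} {g : X → X} {ε : ℝ} {s t : Finset X} {m N : ℕ}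
    (hm : 0 < m) (ht : ∀ x : X, ∃ y ∈ t, dist x y < ε / 2)
    (hs : ∀ x ∈ P, ∀ i : ℕ, N ≤ i → ∃ y ∈ s, ∀ k < m, dist (x (i + k : ℕ)) (g^[k] y) < ε / 2)
    (n : ℕ) : sepCard P n ε ≤ (t.card ^ N * s.card ^ (n / m + 1) : ℕ) := by
  refine iSup₂_le fun E hE => ?_
  choose c hct hc using ht
  have hs' (x : E) (j : ℕ) : ∃ y ∈ s, ∀ k < m,
      dist (x.1 (N + j * m + k : ℕ)) (g^[k] y) < ε / 2 :=
    hs x.1 (hE.1 x.2) _ (Nat.le_add_right _ _)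
  choose b hbs hb using hs'
  let code : E → (Fin N → t) × (Fin (n / m + 1) → s) := fun x =>
    (fun i => ⟨c (x.1 (i : ℕ)), hct _⟩,
      fun j => ⟨b x j, hbs _ _⟩)
  have hcode : Function.Injective code := by
    rintro ⟨x, hx⟩ ⟨y, hy⟩ hxy
    by_contra hne
    obtain ⟨k, hk, hd⟩ := hE.2 hx hy fun h => hne (Subtype.ext h)
    refine hd.not_ge (le_of_lt ?_)
    rcases lt_or_ge k N with hkN | hkN
    · have h : c (x k) = c (y k) :=
        congrArg Subtype.val (congrFun (congrArg Prod.fst hxy) ⟨k, hkN⟩)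
      have h1 := hc (x k)
      have h2 := hc (y k)
      rw [← h] at h2
      linarith [dist_triangle_right (x k) (y k) (c (x k))]
    -- The `n / m + 1` recorded blocks reach every time `N ≤ k < n`, including a last incomplete
    -- block.
    · have hj : (k - N) / m < n / m + 1 :=
        Nat.lt_succ_of_le (Nat.div_le_div_right (by omega))
      have h : b ⟨x, hx⟩ ((k - N) / m) = b ⟨y, hy⟩ ((k - N) / m) :=
        congrArg Subtype.val (congrFun (congrArg Prod.snd hxy) ⟨(k - N) / m, hj⟩)
      have hr := Nat.mod_lt (k - N) hm
      have hk' : N + (k - N) / m * m + (k - N) % m = k := by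
        have := Nat.div_add_mod' (k - N) m
        omega
      have h1 := hb ⟨x, hx⟩ ((k - N) / m) _ hr
      have h2 := hb ⟨y, hy⟩ ((k - N) / m) _ hr
      rw [hk'] at h1 h2
      rw [← h] at h2
      linarith [dist_triangle_right (x k) (y k) (g^[(k - N) % m] (b ⟨x, hx⟩ ((k - N) / m)))]
  calc E.encard = ENat.card E := rfl
    _ ≤ ENat.card ((Fin N → t) × (Fin (n / m + 1) → s)) := ENat.card_le_card_of_injective hcode
    _ = _ := by
      rw [ENat.card_eq_coe_fintype_card]
      simp

/-- The separation rate of forward pseudo orbits is controlled by the number of dynamical balls of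
any fixed length of the limit map. -/
theorem exists_sepRate_forwardPseudoOrbits_le [CompactSpace X] {f : ℕ → X → X} {g : X → X}
    (hg : UniformContinuous g) (hfg : TendstoUniformly f g atTop) {ε : ℝ} (hε : 0 < ε) {m : ℕ}
    (hm : 0 < m) :
    ∃ α : ℝ, 0 < α ∧ sepRate (forwardPseudoOrbits f α) ε ≤
      ENNReal.log (Dynamics.coverMincard g univ {p : X × X | dist p.1 p.2 < ε / 4} m) /
        (m : EReal) := by
  obtain ⟨s, hs, hscard⟩ := (Dynamics.coverMincard_finite_iff g univ _ m).1
    (Dynamics.coverMincard_finite_of_isCompact_uniformContinuous isCompact_univ hg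
      (Metric.dist_mem_uniformity (by positivity : 0 < ε / 4)) m)
  have hsX : ∀ x : X, ∃ y ∈ s, ∀ k < m, dist (g^[k] x) (g^[k] y) < ε / 4 := by
    intro x
    obtain ⟨y, hy, hxy⟩ := hs (mem_univ x)
    exact ⟨y, hy, Dynamics.mem_dynEntourage.1 hxy⟩
  obtain ⟨t₀, -, ht₀, ht⟩ := Metric.finite_approx_of_totallyBounded
    (isCompact_univ (X := X)).totallyBounded (ε / 2) (half_pos hε)
  lift t₀ to Finset X using ht₀
  obtain ⟨α, hα, hshadow⟩ := exists_shadow_of_uniformContinuous hg m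
    (by positivity : 0 < ε / 4)
  -- Half of `α` pays for replacing `f i` by `g`, the other half for the jumps of the pseudo orbit.
  obtain ⟨N, hN⟩ := eventually_atTop.1 (Metric.tendstoUniformly_iff.1 hfg (α / 2) (half_pos hα))
  refine ⟨α / 2, half_pos hα, ?_⟩
  rw [← hscard]
  refine le_trans (limsup_le_limsup (Eventually.of_forall fun n => ?_))
    (limsup_log_mul_pow_div_le (t₀.card ^ N) s.card hm)
  refine EReal.div_le_div_right_of_nonneg (by positivity) (ENNReal.log_monotone ?_)
  have key : sepCard (forwardPseudoOrbits f (α / 2)) n ε ≤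
      (t₀.card ^ N * s.card ^ (n / m + 1) : ℕ) := by
    refine sepCard_le_of_blocks (g := g) hm (fun x => ?_) (fun x hx i hi => ?_) n
    · simpa using ht (mem_univ x)
    -- Shadowing by the orbit of `x i` and covering that orbit cost `ε / 4` each.
    · obtain ⟨y, hy, hxy⟩ := hsX (x i)
      refine ⟨y, hy, fun k hk => ?_⟩
      have h := hshadow (fun j => x (i + j : ℕ)) (fun j => ?_) k hk
      · have := hxy k hk
        simp only [Nat.add_zero] at h
        rw [dist_comm] at h
        linarith [dist_triangle (x (i + k : ℕ)) (g^[k] (x i)) (g^[k] y)]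
      · have h1 := hN (i + j + 1) (by omega) (x (i + j : ℕ))
        have h2 := hx (i + j)
        have h3 := dist_triangle (g (x (i + j : ℕ))) (f (i + j + 1) (x (i + j : ℕ)))
          (x ((i + j : ℕ) + 1))
        have h4 : ((i + (j + 1) : ℕ) : ℤ) = ((i + j : ℕ) : ℤ) + 1 := by push_cast; ring
        simp only [h4]
        linarith
  exact_mod_cast ENat.toENNReal_mono key

/-- The infimum over `α` does not depend on `m`, so a bound for each `m > 0` with its own `α` passes
to the limsup over `m`. -/
theorem forwardPseudoEntropy_le_coverEntropy [CompactSpace X] {f : ℕ → X → X} {g : X → X}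
    (hg : UniformContinuous g) (hfg : TendstoUniformly f g atTop) :
    forwardPseudoEntropy f ≤ Dynamics.coverEntropy g univ := by
  refine iSup₂_le fun ε hε => ?_
  refine le_trans ?_ (Dynamics.coverEntropyEntourage_le_coverEntropy g univ
    (Metric.dist_mem_uniformity (by positivity : 0 < ε / 4)))
  refine le_limsup_of_frequently_le (Eventually.frequently ?_) (by isBoundedDefault)
  filter_upwards [eventually_gt_atTop 0] with m hm
  obtain ⟨α, hα, h⟩ := exists_sepRate_forwardPseudoOrbits_le hg hfg hε hm
  exact iInf₂_le_of_le α hα h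

theorem pseudoEntropy_le_forwardPseudoEntropy (f : ℕ → X → X) :
    pseudoEntropy f ≤ forwardPseudoEntropy f :=
  iSup₂_mono fun _ _ => iInf₂_mono fun _ _ => sepRate_mono (fun _ hx => hx.1) le_rfl

end NDS

/-- Topological entropy of `g` is Mathlib's `Dynamics.coverEntropy g univ`. -/
theorem corollary4p6 {X : Type*} [MetricSpace X] [CompactSpace X]
    (f : ℕ → X → X) (g : X → X)
    (hf : ∀ i : ℕ, 1 ≤ i → Continuous (f i))
    (hfg : TendstoUniformly f g atTop) :
    NDS.pseudoEntropy f ≤ Dynamics.coverEntropy g univ ∧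
      NDS.forwardPseudoEntropy f ≤ Dynamics.coverEntropy g univ := by
  -- `f 0` may be discontinuous; continuity of the maps from index `1` on suffices for the uniform
  -- limit.
  have hg : UniformContinuous g := CompactSpace.uniformContinuous_of_continuous <|
    hfg.continuous ((eventually_ge_atTop 1).mono hf).frequently
  have h := NDS.forwardPseudoEntropy_le_coverEntropy hg hfg
  exact ⟨(NDS.pseudoEntropy_le_forwardPseudoEntropy f).trans h, h⟩
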